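/- Conventions. A directed graph $E=(E^0,E^1,r,s)$ is row-finite with no sources if $vE^1=\{e\in E^1: r(e)=v\}$ is finite and nonempty for every $v\in E^0$. A path is a word $\mu=e_1\cdots e_k$ with $s(e_i)=r(e_{i+1})$, with $r(\mu)=r(e_1)$, $s(\mu)=s(e_k)$ and $|\mu|=k$; vertices are the paths of length $0$. $E^k$ and $E^{<n}$ are the sets of paths of length $k$, respectively of length less than $n$, and $vE^{<n}=\{\mu\in E^{<n}: r(\mu)=v\}$. For a row-finite graph with no sources, a Toeplitz–Cuntz–Krieger $E$-family $(s,p)$ in a $C^*$-algebra consists of partial isometries $s_e$ ($e\in E^1$) and mutually orthogonal projections $p_v$ ($v\in E^0$) with $s_e^*s_e=p_{s(e)}$ and $p_v\ge\sum_{e\in vE^1}s_es_e^*$; it is a Cuntz–Krieger $E$-family if equality holds for all $v$. $\mathcal{T}C^*(E)$ and $C^*(E)$ are the universal $C^*$-algebras generated by a Toeplitz–Cuntz–Krieger, respectively Cuntz–Krieger, $E$-family. For $n\ge 1$, the Kribs–Solel graph $E(n)$ has $E(n)^0=E^{<n}$, $E(n)^1=\{(e,\mu): e\in E^1,\ \mu\in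 s(e)E^{<n}\}$, $s_n(e,\mu)=\mu$, and $r_n(e,\mu)=e\mu$ if $|\mu|<n-1$, $r_n(e,\mu)=r(e)$ if $|\mu|=n-1$. A Toeplitz $n$-representation of $E$ in a $C^*$-algebra is a triple $(T,Q,\Theta)$, where $(T,Q)$ is a Toeplitz–Cuntz–Krieger $E$-family and $\{\Theta_\mu:\mu\in E^{<n}\}$ are mutually orthogonal projections with $Q_v=\sum_{\mu\in vE^{<n}}\Theta_\mu$ for all $v\in E^0$, and \[ T_e^*\Theta_\mu=\begin{cases}\Theta_{\mu'}T_e^*&\text{if }\mu=e\mu',\\ \sum_{e\nu\in E^n}\Theta_\nu T_e^*&\text{if }\mu=r(e),\\ 0&\text{otherwise}\end{cases} \] for all $e\in E^1$ and $\mu\in E^{<n}$. Theorem. Let $E$ be a row-finite directed graph with no sources, let $n\ge 1$, and let $(t_{(e,\mu)},q_\mu)$ be the universal Toeplitz–Cuntz–Krieger $E(n)$-family in $\mathcal{T}C^*(E(n))$. Then the elements \[ t_{n,e}:=\sum_{(e,\mu)\in E(n)^1}t_{(e,\mu)},\qquad q_{n,v}:=\sum_{\mu\in vE^{<n}}q_\mu,\qquad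 \theta_{n,\mu}:=q_\mu \] constitute a Toeplitz $n$-representation of $E$ and generate $\mathcal{T}C^*(E(n))$ as a $C^*$-algebra. For every Toeplitz $n$-representation $(T,Q,\Theta)$ of $E$ in a $C^*$-algebra $B$ there is a $*$-homomorphism $\pi_{T,Q,\Theta}:\mathcal{T}C^*(E(n))\to B$ such that $\pi_{T,Q,\Theta}(t_{n,e})=T_e$, $\pi_{T,Q,\Theta}(q_{n,v})=Q_v$ and $\pi_{T,Q,\Theta}(\theta_{n,\mu})=\Theta_\mu$ for all $e\in E^1$, $v\in E^0$ and $\mu\in E^{<n}$. If $(T,Q)$ is a Cuntz–Krieger $E$-family, then $\pi_{T,Q,\Theta}$ factors through a $*$-homomorphism $\tilde\pi_{T,Q,\Theta}:C^*(E(n))\to B$; that is, $\pi_{T,Q,\Theta}=\tilde\pi_{T,Q,\Theta}\circ\rho$, where $\rho:\mathcal{T}C^*(E(n))\to C^*(E(n))$ is the canonical homomorphism that carries the universal Toeplitz–Cuntz–Krieger $E(n)$-family to the universal Cuntz–Krieger $E(n)$-family. -/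

import Mathlib

open scoped ENNReal

universe u w

/-! ### Directed graphs and paths -/

/-- A directed graph `(E⁰, E¹, r, s)`; parallel edges and loops are allowed, and there is no
restriction on the cardinalities. -/
structure DirectedGraph where
  vertex : Type u
  edge : Type u
  r : edge → vertex
  s : edge → vertex

namespace DirectedGraph

/-- `E` is row-finite if `vE¹ = {e : r(e) = v}` is finite for every vertex `v`. -/
def RowFinite (E : DirectedGraph.{u}) : Prop := ∀ v, {e : E.edge | E.r e = v}.Finite

/-- `E` has no sources if `vE¹` is nonempty for every vertex `v`. -/
def NoSources (E : DirectedGraph.{u}) : Prop := ∀ v, {e : E.edge | E.r e = v}.Nonempty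

/-- `E.IsWordFrom v [e₁, …, eₖ]` says that `r(e₁) = v` (if `k ≥ 1`) and that
`s(eᵢ) = r(eᵢ₊₁)` for all `i < k`. -/
def IsWordFrom (E : DirectedGraph.{u}) : E.vertex → List E.edge → Prop
  | _, [] => True
  | v, e :: l => E.r e = v ∧ E.IsWordFrom (E.s e) l

/-- `E*`: a finite path `μ`, recorded as its range `r(μ)` and the word of its edges. The paths of
length `0` are the vertices. -/
@[ext]
structure Path (E : DirectedGraph.{u}) where
  range : E.vertex
  word : List E.edge
  isWord : E.IsWordFrom range word

/-- The length `|μ|`. -/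
def Path.length {E : DirectedGraph.{u}} (μ : E.Path) : ℕ := μ.word.length

/-- A vertex, regarded as a path of length `0`. -/
def Path.ofVertex {E : DirectedGraph.{u}} (v : E.vertex) : E.Path := ⟨v, [], trivial⟩

/-- The path `eμ`, defined when `r(μ) = s(e)`. -/
def Path.cons {E : DirectedGraph.{u}} (e : E.edge) (μ : E.Path) (h : μ.range = E.s e) : E.Path :=
  ⟨E.r e, e :: μ.word, rfl, h ▸ μ.isWord⟩

/-- `E^{<n}`, the set of paths of length less than `n`. -/
def PathLT (E : DirectedGraph.{u}) (n : ℕ) : Type u := {μ : E.Path // μ.length < n}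

/-- The range `r(μ)` of `μ ∈ E^{<n}`. -/
def PathLT.range {E : DirectedGraph.{u}} {n : ℕ} (μ : E.PathLT n) : E.vertex := μ.1.range

/-- The length `|μ|` of `μ ∈ E^{<n}`. -/
def PathLT.length {E : DirectedGraph.{u}} {n : ℕ} (μ : E.PathLT n) : ℕ := μ.1.length

/-- A vertex as an element of `E^{<n}`, for `n > 0`. -/
def PathLT.ofVertex {E : DirectedGraph.{u}} {n : ℕ} (hn : 0 < n) (v : E.vertex) : E.PathLT n :=
  ⟨Path.ofVertex v, hn⟩

/-- The path `eμ ∈ E^{<n}`, defined when `r(μ) = s(e)` and `|μ| + 1 < n`. -/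
def PathLT.cons {E : DirectedGraph.{u}} {n : ℕ} (e : E.edge) (μ : E.PathLT n)
    (h : μ.range = E.s e) (hl : μ.length + 1 < n) : E.PathLT n :=
  ⟨Path.cons e μ.1 h, hl⟩

open Classical in
/-- The Kribs–Solel graph `E(n)`, with vertex set `E^{<n}`, edge set
`{(e, μ) : e ∈ E¹, μ ∈ s(e)E^{<n}}`, source map `(e, μ) ↦ μ`, and range map `(e, μ) ↦ eμ` if
`|μ| < n - 1` and `(e, μ) ↦ r(e)` if `|μ| = n - 1`. -/
noncomputable def kribsSolel (E : DirectedGraph.{u}) (n : ℕ) : DirectedGraph.{u} where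
  vertex := E.PathLT n
  edge := {x : E.edge × E.PathLT n // x.2.range = E.s x.1}
  r x := if hl : x.1.2.length + 1 < n then PathLT.cons x.1.1 x.1.2 x.2 hl
    else PathLT.ofVertex (Nat.zero_lt_of_lt x.1.2.2) (E.r x.1.1)
  s x := x.1.2

/-! ### Toeplitz–Cuntz–Krieger families and their universal C*-algebras -/

/-- A Toeplitz–Cuntz–Krieger `E`-family in a C*-algebra (for row-finite `E`, which makes the sums
in `sum_le` finite). The inequality is that of the C*-algebraic order: `b - a` is self-adjoint with
nonnegative spectrum. -/
structure IsToeplitzCuntzKrieger (E : DirectedGraph.{u}) {A : Type w} [NonUnitalCStarAlgebra A]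
    (s : E.edge → A) (p : E.vertex → A) : Prop where
  partial_isometry : ∀ e, s e * star (s e) * s e = s e
  projection : ∀ v, IsStarProjection (p v)
  orthogonal : ∀ v v', v ≠ v' → p v * p v' = 0
  star_mul_self : ∀ e, star (s e) * s e = p (E.s e)
  sum_le : ∀ v, (CStarAlgebra.spectralOrder A).le
    (∑ᶠ e : {e : E.edge // E.r e = v}, s e * star (s e)) (p v)

/-- A Cuntz–Krieger `E`-family (for row-finite `E` with no sources). -/
structure IsCuntzKrieger (E : DirectedGraph.{u}) {A : Type w} [NonUnitalCStarAlgebra A]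
    (s : E.edge → A) (p : E.vertex → A) : Prop extends IsToeplitzCuntzKrieger E s p where
  sum_eq : ∀ v, ∑ᶠ e : {e : E.edge // E.r e = v}, s e * star (s e) = p v

theorem IsToeplitzCuntzKrieger.norm_le {E : DirectedGraph.{u}} {A : Type w}
    [NonUnitalCStarAlgebra A] {s : E.edge → A} {p : E.vertex → A}
    (h : E.IsToeplitzCuntzKrieger s p) (x : E.edge ⊕ E.vertex) : ‖Sum.elim s p x‖ ≤ 1 := by
  cases x with
  | inr v => exact (h.projection v).norm_le
  | inl e =>
    have h1 : ‖s e‖ * ‖s e‖ ≤ 1 := by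
      rw [← CStarRing.norm_star_mul_self, h.star_mul_self e]
      exact (h.projection _).norm_le
    simp only [Sum.elim_inl]
    nlinarith [norm_nonneg (s e)]

/-- The type of all Toeplitz–Cuntz–Krieger `E`-families `(s, p)` in C*-algebras `B` satisfying an
additional condition `P` (up to isomorphism, every family that generates its C*-algebra occurs
with `B` in the universe of `E`). -/
structure Family (E : DirectedGraph.{u})
    (P : ∀ (B : Type u) [NonUnitalCStarAlgebra B], (E.edge → B) → (E.vertex → B) → Prop) where
  B : Type u
  [inst : NonUnitalCStarAlgebra B]
  s : E.edge → B
  p : E.vertex → B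
  isToeplitzCuntzKrieger : E.IsToeplitzCuntzKrieger s p
  prop : P B s p

attribute [instance] Family.inst

section Universal

variable (E : DirectedGraph.{u})
  (P : ∀ (B : Type u) [NonUnitalCStarAlgebra B], (E.edge → B) → (E.vertex → B) → Prop)

/-- The `ℓ^∞`-direct product of the C*-algebras of all families. -/
abbrev FamilyProd : Type (u + 1) := lp (fun i : E.Family P => i.B) ∞

/-- The direct product of all families. -/
def prodGen (x : E.edge ⊕ E.vertex) : E.FamilyProd P :=
  ⟨fun i => Sum.elim i.s i.p x, memℓp_infty ⟨1, by
    rintro _ ⟨i, rfl⟩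
    exact i.isToeplitzCuntzKrieger.norm_le x⟩⟩

/-- The universal C*-algebra generated by a Toeplitz–Cuntz–Krieger `E`-family satisfying `P`:
the closed `*`-subalgebra of the direct product that is generated by the direct product of all
families. The norm of a `*`-polynomial in the generators is thus the supremum of its norms over
all families. -/
noncomputable def universalSubalgebra : NonUnitalStarSubalgebra ℂ (E.FamilyProd P) :=
  (NonUnitalStarAlgebra.adjoin ℂ (Set.range (E.prodGen P))).topologicalClosure

instance : IsClosed (E.universalSubalgebra P : Set (E.FamilyProd P)) :=
  NonUnitalStarSubalgebra.isClosed_topologicalClosure _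

/-- The generators of the universal C*-algebra. -/
noncomputable def universalGen (x : E.edge ⊕ E.vertex) : E.universalSubalgebra P :=
  ⟨E.prodGen P x, NonUnitalStarSubalgebra.le_topologicalClosure _
    (NonUnitalStarAlgebra.subset_adjoin ℂ _ ⟨x, rfl⟩)⟩

end Universal

/-- The Toeplitz algebra `𝒯C*(E)`, the universal C*-algebra generated by a
Toeplitz–Cuntz–Krieger `E`-family. -/
def ToeplitzAlgebra (E : DirectedGraph.{u}) : Type (u + 1) :=
  E.universalSubalgebra (fun _ _ _ _ => True)

noncomputable instance (E : DirectedGraph.{u}) : NonUnitalCStarAlgebra E.ToeplitzAlgebra :=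
  inferInstanceAs (NonUnitalCStarAlgebra (E.universalSubalgebra (fun _ _ _ _ => True)))

/-- The partial isometries `t_e` of the universal Toeplitz–Cuntz–Krieger `E`-family. -/
noncomputable def toeplitzEdge (E : DirectedGraph.{u}) (e : E.edge) : E.ToeplitzAlgebra :=
  E.universalGen _ (.inl e)

/-- The projections `q_v` of the universal Toeplitz–Cuntz–Krieger `E`-family. -/
noncomputable def toeplitzVertex (E : DirectedGraph.{u}) (v : E.vertex) : E.ToeplitzAlgebra :=
  E.universalGen _ (.inr v)

/-- The graph algebra `C*(E)`, the universal C*-algebra generated by a Cuntz–Krieger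
`E`-family. -/
def GraphAlgebra (E : DirectedGraph.{u}) : Type (u + 1) :=
  E.universalSubalgebra (fun _ _ s p => E.IsCuntzKrieger s p)

noncomputable instance (E : DirectedGraph.{u}) : NonUnitalCStarAlgebra E.GraphAlgebra :=
  inferInstanceAs (NonUnitalCStarAlgebra
    (E.universalSubalgebra (fun _ _ s p => E.IsCuntzKrieger s p)))

/-- The partial isometries `s_e` of the universal Cuntz–Krieger `E`-family. -/
noncomputable def graphEdge (E : DirectedGraph.{u}) (e : E.edge) : E.GraphAlgebra :=
  E.universalGen _ (.inl e)

/-- The projections `p_v` of the universal Cuntz–Krieger `E`-family. -/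
noncomputable def graphVertex (E : DirectedGraph.{u}) (v : E.vertex) : E.GraphAlgebra :=
  E.universalGen _ (.inr v)

/-! ### Toeplitz `n`-representations -/

/-- A Toeplitz `n`-representation `(T, Q, Θ)` of `E` in a C*-algebra. The last three fields are the
three cases `μ = eμ'`, `μ = r(e)` and "otherwise" of the formula for `T_e^* Θ_μ`. -/
structure IsToeplitzNRep (E : DirectedGraph.{u}) (n : ℕ) [NeZero n] {A : Type w}
    [NonUnitalCStarAlgebra A] (T : E.edge → A) (Q : E.vertex → A) (Θ : E.PathLT n → A) : Prop where
  isToeplitzCuntzKrieger : E.IsToeplitzCuntzKrieger T Q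
  projection : ∀ μ, IsStarProjection (Θ μ)
  orthogonal : ∀ μ ν, μ ≠ ν → Θ μ * Θ ν = 0
  sum_eq : ∀ v, Q v = ∑ᶠ μ : {μ : E.PathLT n // μ.range = v}, Θ μ
  rel_cons : ∀ (e : E.edge) (μ' : E.PathLT n) (h : μ'.range = E.s e) (hl : μ'.length + 1 < n),
    star (T e) * Θ (PathLT.cons e μ' h hl) = Θ μ' * star (T e)
  rel_vertex : ∀ e : E.edge, star (T e) * Θ (PathLT.ofVertex (NeZero.pos n) (E.r e)) =
    ∑ᶠ ν : {ν : E.PathLT n // ν.range = E.s e ∧ ν.length + 1 = n}, Θ ν * star (T e)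
  rel_zero : ∀ (e : E.edge) (μ : E.PathLT n),
    (¬ ∃ (μ' : E.PathLT n) (h : μ'.range = E.s e) (hl : μ'.length + 1 < n),
      μ = PathLT.cons e μ' h hl) →
    μ ≠ PathLT.ofVertex (NeZero.pos n) (E.r e) → star (T e) * Θ μ = 0

/-- `t_{n,e} = ∑_{(e,μ) ∈ E(n)¹} t_{(e,μ)}` in `𝒯C*(E(n))`. -/
noncomputable def nEdge (E : DirectedGraph.{u}) (n : ℕ) (e : E.edge) :
    (E.kribsSolel n).ToeplitzAlgebra :=
  ∑ᶠ μ : {μ : E.PathLT n // μ.range = E.s e}, (E.kribsSolel n).toeplitzEdge ⟨(e, μ.1), μ.2⟩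

/-- `q_{n,v} = ∑_{μ ∈ vE^{<n}} q_μ` in `𝒯C*(E(n))`. -/
noncomputable def nVertex (E : DirectedGraph.{u}) (n : ℕ) (v : E.vertex) :
    (E.kribsSolel n).ToeplitzAlgebra :=
  ∑ᶠ μ : {μ : E.PathLT n // μ.range = v}, (E.kribsSolel n).toeplitzVertex μ.1

/-- `θ_{n,μ} = q_μ` in `𝒯C*(E(n))`. -/
noncomputable def nTheta (E : DirectedGraph.{u}) (n : ℕ) (μ : E.PathLT n) :
    (E.kribsSolel n).ToeplitzAlgebra :=
  (E.kribsSolel n).toeplitzVertex μ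

end DirectedGraph

/-! Toeplitz–Cuntz–Krieger `E(n)`-families and Toeplitz `n`-representations of `E` determine each
other. From a representation one gets t_(e,μ) = T_e Θ_μ and q_μ = Θ_μ; from a family, T_e is the sum
of the t_(e,μ) over μ ∈ s(e)E^{<n}. These passages are mutually inverse because T_e = T_e Q_{s(e)} =
∑ T_e Θ_μ and (∑_ν t_(e,ν)) q_μ = t_(e,μ). The formula for T_e^* Θ_μ encodes the range map of
`E(n)`. The passages are `isToeplitzNRep` and `isToeplitzCuntzKrieger_kribsSolel`;
`exists_universalSubalgebra_hom` turns families into homomorphisms.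

The Toeplitz inequality is awkward to transport. For row-finite graphs, given the other relations,
it is equivalent to the equations p_{r(e)} s_e = s_e and s_e^* s_f = 0 for e ≠ f (`vertex_mul`,
`star_mul_of_ne`, `of_relations`), so that all checks become algebra.

In the Cuntz–Krieger case, Θ_μ = Q_{r(μ)} Θ_μ = ∑ T_f Θ_ν T_f^* Θ_μ over f ∈ r(μ)E¹ and ν ∈
s(f)E^{<n}. Since T_f Θ_ν T_f^* lies under the projection Θ at the range of (f,ν), only the edges
with range μ contribute; this is the Cuntz–Krieger relation at μ. -/

namespace DirectedGraph

/-! ### Equational form of the Toeplitz–Cuntz–Krieger relations -/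

section Relations

variable {E : DirectedGraph.{u}} {A : Type w} [NonUnitalCStarAlgebra A]
  {s : E.edge → A} {p : E.vertex → A}

theorem RowFinite.finite (hfin : E.RowFinite) (v : E.vertex) :
    Finite {e : E.edge // E.r e = v} :=
  (hfin v).to_subtype

namespace IsToeplitzCuntzKrieger

theorem mul_vertex (h : E.IsToeplitzCuntzKrieger s p) (e : E.edge) :
    s e * p (E.s e) = s e := by
  rw [← h.star_mul_self, ← mul_assoc, h.partial_isometry]

theorem isStarProjection_mul_star (h : E.IsToeplitzCuntzKrieger s p) (e : E.edge) :
    IsStarProjection (s e * star (s e)) where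
  isIdempotentElem := by
    rw [IsIdempotentElem, ← mul_assoc, h.partial_isometry]
  isSelfAdjoint := IsSelfAdjoint.mul_star_self _

/-- The range projection of s_e is one positive summand of a sum dominated by p_{r(e)}, and order
between projections means absorption under multiplication. -/
theorem vertex_mul (hfin : E.RowFinite) (h : E.IsToeplitzCuntzKrieger s p) (e : E.edge) :
    p (E.r e) * s e = s e := by
  let _ := CStarAlgebra.spectralOrder A
  have := CStarAlgebra.spectralOrderedRing A
  have := hfin.finite (E.r e)
  have := Fintype.ofFinite {f : E.edge // E.r f = E.r e}
  have hs := h.sum_le (E.r e)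
  rw [finsum_eq_sum_of_fintype] at hs
  have hle : s e * star (s e) ≤ p (E.r e) :=
    (Finset.single_le_sum (f := fun f : {f : E.edge // E.r f = E.r e} => s f * star (s f))
      (fun f _ => mul_star_self_nonneg _) (Finset.mem_univ ⟨e, rfl⟩)).trans hs
  have := ((h.isStarProjection_mul_star e).le_iff_mul_eq_right (h.projection _)).1 hle
  calc p (E.r e) * s e = p (E.r e) * (s e * star (s e)) * s e := by
        rw [mul_assoc, h.partial_isometry]
    _ = s e := by rw [this, h.partial_isometry]

/-- Edges with distinct ranges sit under orthogonal vertex projections. If the ranges agree, two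
range projections whose sum lies below a projection must be orthogonal. -/
theorem star_mul_of_ne (hfin : E.RowFinite) (h : E.IsToeplitzCuntzKrieger s p) {e f : E.edge}
    (hef : e ≠ f) : star (s e) * s f = 0 := by
  let _ := CStarAlgebra.spectralOrder A
  have := CStarAlgebra.spectralOrderedRing A
  by_cases hr : E.r e = E.r f
  · have := hfin.finite (E.r e)
    have := Fintype.ofFinite {f : E.edge // E.r f = E.r e}
    classical
    have hs := h.sum_le (E.r e)
    rw [finsum_eq_sum_of_fintype] at hs
    have hle : s e * star (s e) + s f * star (s f) ≤ p (E.r e) := by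
      refine le_trans ?_ hs
      have := Finset.sum_le_sum_of_subset_of_nonneg
        (f := fun f : {f : E.edge // E.r f = E.r e} => s f * star (s f))
        (Finset.subset_univ {⟨e, rfl⟩, ⟨f, hr.symm⟩}) (fun f _ _ => mul_star_self_nonneg _)
      rwa [Finset.sum_pair (by simpa using hef)] at this
    have he : p (E.r e) * (s e * star (s e)) = s e * star (s e) := by
      rw [← mul_assoc, h.vertex_mul hfin]
    have hf : p (E.r e) * (s f * star (s f)) = s f * star (s f) := by
      rw [← mul_assoc, hr, h.vertex_mul hfin]
    -- The difference is again a projection, and it dominates s_f s_f^*; absorbing s_f s_f^* into it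
    -- forces s_e s_e^* s_f s_f^* = 0.
    have hp : IsStarProjection (p (E.r e) - s e * star (s e)) :=
      ((h.isStarProjection_mul_star e).le_iff_sub (h.projection _)).1
        (((h.isStarProjection_mul_star e).le_iff_mul_eq_right (h.projection _)).2 he)
    have h0 := ((h.isStarProjection_mul_star f).le_iff_mul_eq_right hp).1
      (le_sub_iff_add_le'.2 hle)
    rw [sub_mul, hf, sub_eq_self] at h0
    calc star (s e) * s f
        = star (s e * star (s e) * s e) * (s f * star (s f) * s f) := by
          rw [h.partial_isometry, h.partial_isometry]
      _ = star (s e) * (s e * star (s e) * (s f * star (s f))) * s f := by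
          simp only [star_mul, star_star, mul_assoc]
      _ = 0 := by rw [h0, mul_zero, zero_mul]
  · calc star (s e) * s f = star (p (E.r e) * s e) * (p (E.r f) * s f) := by
          rw [h.vertex_mul hfin, h.vertex_mul hfin]
      _ = star (s e) * (p (E.r e) * p (E.r f)) * s f := by
          rw [star_mul, (h.projection _).isSelfAdjoint.star_eq]
          simp only [mul_assoc]
      _ = 0 := by rw [h.orthogonal _ _ hr, mul_zero, zero_mul]

/-- The Toeplitz–Cuntz–Krieger inequality follows from algebraic relations. -/
theorem of_relations (hfin : E.RowFinite) (h1 : ∀ e, s e * star (s e) * s e = s e)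
    (h2 : ∀ v, IsStarProjection (p v)) (h3 : ∀ v v', v ≠ v' → p v * p v' = 0)
    (h4 : ∀ e, star (s e) * s e = p (E.s e)) (h5 : ∀ e, p (E.r e) * s e = s e)
    (h6 : ∀ e f, e ≠ f → star (s e) * s f = 0) : E.IsToeplitzCuntzKrieger s p where
  partial_isometry := h1
  projection := h2
  orthogonal := h3
  star_mul_self := h4
  sum_le v := by
    let _ := CStarAlgebra.spectralOrder A
    have := CStarAlgebra.spectralOrderedRing A
    have := hfin.finite v
    have := Fintype.ofFinite {f : E.edge // E.r f = v}
    rw [finsum_eq_sum_of_fintype]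
    have hq : IsStarProjection (∑ f : {f : E.edge // E.r f = v}, s f * star (s f)) := by
      constructor
      · rw [IsIdempotentElem, Finset.sum_mul]
        refine Finset.sum_congr rfl fun e _ => ?_
        rw [Finset.mul_sum, Finset.sum_eq_single e]
        · rw [← mul_assoc, h1]
        · intro f _ hf
          rw [mul_assoc, ← mul_assoc (star (s e)), h6 _ _ fun h => hf (Subtype.ext h.symm),
            zero_mul, mul_zero]
        · simp
      · rw [isSelfAdjoint_iff, star_sum]
        simp
    refine (hq.le_iff_mul_eq_right (h2 v)).2 ?_
    rw [Finset.mul_sum]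
    refine Finset.sum_congr rfl fun e _ => ?_
    obtain ⟨e, rfl⟩ := e
    rw [← mul_assoc, h5]

end IsToeplitzCuntzKrieger

/-- The Toeplitz–Cuntz–Krieger relations may be checked after applying a jointly injective family
of `*`-homomorphisms. -/
theorem IsToeplitzCuntzKrieger.of_jointly_injective (hfin : E.RowFinite) {ι : Type*}
    {B : ι → Type*} [∀ i, NonUnitalCStarAlgebra (B i)] (φ : ∀ i, A →⋆ₙₐ[ℂ] B i)
    (hφ : ∀ a b : A, (∀ i, φ i a = φ i b) → a = b)
    (h : ∀ i, E.IsToeplitzCuntzKrieger (fun e => φ i (s e)) (fun v => φ i (p v))) :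
    E.IsToeplitzCuntzKrieger s p := by
  -- Only equations have to be checked here, and these are detected by the maps jointly; the order
  -- relation itself never has to be reflected.
  refine .of_relations hfin (fun e => hφ _ _ fun i => ?_) (fun v => ⟨hφ _ _ fun i => ?_,
    hφ _ _ fun i => ?_⟩) (fun v v' hv => hφ _ _ fun i => ?_) (fun e => hφ _ _ fun i => ?_)
    (fun e => hφ _ _ fun i => ?_) (fun e f hef => hφ _ _ fun i => ?_)
  · simpa [map_star] using (h i).partial_isometry e
  · simpa using ((h i).projection v).isIdempotentElem.eq
  · simpa [map_star] using ((h i).projection v).isSelfAdjoint.star_eq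
  · simpa using (h i).orthogonal v v' hv
  · simpa [map_star] using (h i).star_mul_self e
  · simpa using (h i).vertex_mul hfin e
  · simpa [map_star] using (h i).star_mul_of_ne hfin hef

theorem IsCuntzKrieger.of_jointly_injective (hfin : E.RowFinite) {ι : Type*}
    {B : ι → Type*} [∀ i, NonUnitalCStarAlgebra (B i)] (φ : ∀ i, A →⋆ₙₐ[ℂ] B i)
    (hφ : ∀ a b : A, (∀ i, φ i a = φ i b) → a = b)
    (h : ∀ i, E.IsCuntzKrieger (fun e => φ i (s e)) (fun v => φ i (p v))) :
    E.IsCuntzKrieger s p where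
  toIsToeplitzCuntzKrieger :=
    .of_jointly_injective hfin φ hφ fun i => (h i).toIsToeplitzCuntzKrieger
  sum_eq v := hφ _ _ fun i => by
    have := hfin.finite v
    have := Fintype.ofFinite {f : E.edge // E.r f = v}
    have := (h i).sum_eq v
    rw [finsum_eq_sum_of_fintype] at this ⊢
    simpa [map_star] using this

end Relations

end DirectedGraph

/-! ### Small models of C*-algebras and generating families -/

section Small

/-- A C*-algebra structure transported along an equivalence. -/
noncomputable abbrev Equiv.nonUnitalCStarAlgebra {A : Type*} {B : Type*} (e : A ≃ B)
    [NonUnitalCStarAlgebra B] : NonUnitalCStarAlgebra A :=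
  letI := e.nonUnitalRing
  letI := e.module ℂ
  letI := e.starRing
  letI : NonUnitalNormedRing A := NonUnitalNormedRing.induced A B e.ringEquiv e.injective
  letI : NormedSpace ℂ A := NormedSpace.induced ℂ A B (e.linearEquiv ℂ)
  have hiso : Isometry e := Isometry.of_dist_eq fun _ _ => rfl
  have hmul : ∀ a b : A, e (a * b) = e a * e b := fun a b => e.apply_symm_apply _
  have hsmul : ∀ (c : ℂ) (a : A), e (c • a) = c • e a := fun c a => e.apply_symm_apply _
  have hstar : ∀ a : A, e (star a) = star (e a) := fun a => e.apply_symm_apply _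
  { complete := ((completeSpace_congr (α := A) (β := B) (e := e)
      hiso.isUniformInducing.isUniformEmbedding).2 inferInstance).complete
    norm_mul_self_le := fun a => by
      have := CStarRing.norm_mul_self_le (e a)
      change ‖e a‖ * ‖e a‖ ≤ ‖e (star a * a)‖
      rwa [hmul, hstar]
    smul_assoc := fun c a b => e.injective (by simp [hmul, hsmul, smul_mul_assoc])
    smul_comm := fun c a b => e.injective (by simp [hmul, hsmul, mul_smul_comm])
    star_smul := fun c a => e.injective (by simp [hstar, hsmul, star_smul]) }

/-- The equivalence along which a C*-algebra structure was transported. -/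
noncomputable def Equiv.nonUnitalStarAlgHom {A : Type*} {B : Type*} (e : A ≃ B)
    [NonUnitalCStarAlgebra B] :
    letI := e.nonUnitalCStarAlgebra
    A →⋆ₙₐ[ℂ] B :=
  letI := e.nonUnitalCStarAlgebra
  { toFun := e
    map_smul' := fun _ _ => e.apply_symm_apply _
    map_zero' := e.apply_symm_apply _
    map_add' := fun _ _ => e.apply_symm_apply _
    map_mul' := fun _ _ => e.apply_symm_apply _
    map_star' := fun _ => e.apply_symm_apply _ }

/-- Formal `*`-polynomials without constant term. -/
inductive StarPolynomial (X : Type u) : Type u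
  | var : X → StarPolynomial X
  | zero : StarPolynomial X
  | add : StarPolynomial X → StarPolynomial X → StarPolynomial X
  | mul : StarPolynomial X → StarPolynomial X → StarPolynomial X
  | smul : ℂ → StarPolynomial X → StarPolynomial X
  | conj : StarPolynomial X → StarPolynomial X

/-- The value of a formal `*`-polynomial at a point. -/
noncomputable def StarPolynomial.eval {X : Type u} {A : Type*} [NonUnitalCStarAlgebra A]
    (g : X → A) : StarPolynomial X → A
  | var x => g x
  | zero => 0
  | add a b => a.eval g + b.eval g
  | mul a b => a.eval g * b.eval g
  | smul c a => c • a.eval g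
  | conj a => star (a.eval g)

variable {X : Type u} {A : Type*} [NonUnitalCStarAlgebra A] (g : X → A)

theorem adjoin_range_subset_range_eval :
    (NonUnitalStarAlgebra.adjoin ℂ (Set.range g) : Set A) ⊆
      Set.range (StarPolynomial.eval g) := by
  intro a ha
  induction ha using NonUnitalStarAlgebra.adjoin_induction with
  | mem _ hx =>
    obtain ⟨x, rfl⟩ := hx
    exact ⟨.var x, rfl⟩
  | add _ _ _ _ hx hy =>
    obtain ⟨⟨x, rfl⟩, ⟨y, rfl⟩⟩ := hx, hy
    exact ⟨.add x y, rfl⟩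
  | zero => exact ⟨.zero, rfl⟩
  | mul _ _ _ _ hx hy =>
    obtain ⟨⟨x, rfl⟩, ⟨y, rfl⟩⟩ := hx, hy
    exact ⟨.mul x y, rfl⟩
  | smul c _ _ hx =>
    obtain ⟨x, rfl⟩ := hx
    exact ⟨.smul c x, rfl⟩
  | star _ _ hx =>
    obtain ⟨x, rfl⟩ := hx
    exact ⟨.conj x, rfl⟩

/-- A C*-algebra generated by a `u`-small family is `u`-small. -/
theorem small_topologicalClosure_adjoin :
    Small.{u} (NonUnitalStarAlgebra.adjoin ℂ (Set.range g)).topologicalClosure := by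
  -- Every point of the closure is a limit of a sequence of polynomial values, so sequences of
  -- formal polynomials, a `u`-small type, index it. Divergent sequences give junk values of
  -- `limUnder`, harmless since only an inclusion is needed.
  have hsub : ((NonUnitalStarAlgebra.adjoin ℂ (Set.range g)).topologicalClosure : Set A) ⊆
      Set.range (fun σ : ℕ → StarPolynomial X =>
        Filter.limUnder Filter.atTop fun k => (σ k).eval g) := by
    intro a ha
    obtain ⟨x, hx, hlim⟩ := mem_closure_iff_seq_limit.1 ha
    choose σ hσ using fun k => adjoin_range_subset_range_eval g (hx k)
    exact ⟨σ, by simpa only [hσ] using hlim.limUnder_eq⟩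
  exact small_subset hsub

end Small

/-- A family in a C*-subalgebra that generates it as a subset of the ambient algebra generates it
intrinsically. -/
theorem NonUnitalStarAlgebra.topologicalClosure_adjoin_eq_top {X A : Type*}
    [NonUnitalCStarAlgebra A] (S : NonUnitalStarSubalgebra ℂ A) [IsClosed (S : Set A)] (g : X → S)
    (hS : S ≤ (NonUnitalStarAlgebra.adjoin ℂ
      (Set.range fun x => (g x : A))).topologicalClosure) :
    (NonUnitalStarAlgebra.adjoin ℂ (Set.range g)).topologicalClosure = ⊤ := by
  rw [eq_top_iff]
  intro a
  have himage : NonUnitalStarAlgebra.adjoin ℂ (Set.range fun x => (g x : A)) ≤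
      (NonUnitalStarAlgebra.adjoin ℂ (Set.range g)).map
        (NonUnitalStarSubalgebraClass.subtype S) := by
    refine NonUnitalStarAlgebra.adjoin_le ?_
    rintro _ ⟨x, rfl⟩
    exact ⟨g x, NonUnitalStarAlgebra.subset_adjoin ℂ _ ⟨x, rfl⟩, rfl⟩
  exact closure_subtype.2 (closure_mono himage (hS a.2))

open scoped CStarAlgebra in
/-- `*`-homomorphisms of C*-algebras that agree on a generating family are equal. -/
theorem NonUnitalStarAlgHom.ext_of_topologicalClosure_adjoin {X A B : Type*}
    [NonUnitalCStarAlgebra A] [NonUnitalCStarAlgebra B] {g : X → A}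
    (hg : (NonUnitalStarAlgebra.adjoin ℂ (Set.range g)).topologicalClosure = ⊤)
    {φ ψ : A →⋆ₙₐ[ℂ] B} (h : ∀ x, φ (g x) = ψ (g x)) : φ = ψ := by
  have hle : NonUnitalStarAlgebra.adjoin ℂ (Set.range g) ≤ NonUnitalStarAlgHom.equalizer φ ψ := by
    refine NonUnitalStarAlgebra.adjoin_le ?_
    rintro _ ⟨x, rfl⟩
    exact h x
  -- `*`-homomorphisms between C*-algebras are automatically continuous.
  have hclosed : IsClosed (NonUnitalStarAlgHom.equalizer φ ψ : Set A) :=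
    isClosed_eq (map_continuous φ) (map_continuous ψ)
  have := NonUnitalStarSubalgebra.topologicalClosure_minimal _ hle hclosed
  rw [hg] at this
  exact NonUnitalStarAlgHom.ext fun a => this (NonUnitalStarAlgebra.mem_top (x := a))

namespace DirectedGraph

/-! ### Universal properties of the Toeplitz and graph algebras -/

section Universal

variable {E : DirectedGraph.{u}}
  {P : ∀ (B : Type u) [NonUnitalCStarAlgebra B], (E.edge → B) → (E.vertex → B) → Prop}

/-- The coordinate homomorphisms of the universal C*-algebra. -/
def universalEval (i : E.Family P) : E.universalSubalgebra P →⋆ₙₐ[ℂ] i.B where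
  toFun a := (a : E.FamilyProd P) i
  map_smul' _ _ := rfl
  map_zero' := rfl
  map_add' _ _ := rfl
  map_mul' _ _ := rfl
  map_star' _ := rfl

theorem universalEval_universalGen (i : E.Family P) (x : E.edge ⊕ E.vertex) :
    universalEval i (E.universalGen P x) = Sum.elim i.s i.p x := rfl

theorem universalEval_jointly_injective (a b : E.universalSubalgebra P)
    (h : ∀ i, universalEval i a = universalEval i b) : a = b :=
  Subtype.ext (lp.ext (funext h))

variable (E P) in
theorem topologicalClosure_adjoin_universalGen :
    (NonUnitalStarAlgebra.adjoin ℂ (Set.range (E.universalGen P))).topologicalClosure = ⊤ :=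
  NonUnitalStarAlgebra.topologicalClosure_adjoin_eq_top (E.universalSubalgebra P) _ le_rfl

/-- The universal property of the universal C*-algebra, for a condition `P` that is inherited by
C*-subalgebras. -/
theorem exists_universalSubalgebra_hom (hfin : E.RowFinite) {B : Type w}
    [NonUnitalCStarAlgebra B] {s : E.edge → B} {p : E.vertex → B}
    (h : E.IsToeplitzCuntzKrieger s p)
    (hP : ∀ (C : Type u) [NonUnitalCStarAlgebra C] (φ : C →⋆ₙₐ[ℂ] B), Function.Injective φ →
      ∀ (s' : E.edge → C) (p' : E.vertex → C), (∀ e, φ (s' e) = s e) → (∀ v, φ (p' v) = p v) →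
        P C s' p') :
    ∃ π : E.universalSubalgebra P →⋆ₙₐ[ℂ] B,
      ∀ x, π (E.universalGen P x) = Sum.elim s p x := by
  let S := (NonUnitalStarAlgebra.adjoin ℂ (Set.range (Sum.elim s p))).topologicalClosure
  have : IsClosed (S : Set B) := NonUnitalStarSubalgebra.isClosed_topologicalClosure _
  -- `B` lives in an arbitrary universe, while the product runs over families in universe `u`.
  -- Shrinking the generated subalgebra makes the given family one of the coordinates, and the
  -- required map is that coordinate followed by the inclusion.
  have : Small.{u} S := small_topologicalClosure_adjoin _
  let e : Shrink.{u} S ≃ S := (equivShrink S).symm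
  let := e.nonUnitalCStarAlgebra
  let φ : Shrink.{u} S →⋆ₙₐ[ℂ] B :=
    (NonUnitalStarSubalgebraClass.subtype S).comp e.nonUnitalStarAlgHom
  have hφ : Function.Injective φ := Subtype.val_injective.comp e.injective
  have hmem : ∀ x, Sum.elim s p x ∈ S := fun x =>
    NonUnitalStarSubalgebra.le_topologicalClosure _
      (NonUnitalStarAlgebra.subset_adjoin ℂ _ ⟨x, rfl⟩)
  let g : E.edge ⊕ E.vertex → Shrink.{u} S := fun x => e.symm ⟨Sum.elim s p x, hmem x⟩
  have hg : ∀ x, φ (g x) = Sum.elim s p x := fun x => congrArg Subtype.val (e.apply_symm_apply _)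
  let i : E.Family P :=
    { B := Shrink.{u} S
      s := fun e => g (.inl e)
      p := fun v => g (.inr v)
      isToeplitzCuntzKrieger := by
        refine .of_jointly_injective (ι := Unit) hfin (fun _ => φ)
          (fun a b hab => hφ (hab ())) fun _ => ?_
        simpa only [hg, Sum.elim_inl, Sum.elim_inr] using h
      prop := hP _ φ hφ _ _ (fun e => hg (.inl e)) (fun v => hg (.inr v)) }
  refine ⟨φ.comp (universalEval i), fun x => ?_⟩
  rw [NonUnitalStarAlgHom.comp_apply, universalEval_universalGen, ← hg x]
  cases x <;> rfl

theorem isToeplitzCuntzKrieger_toeplitz (hfin : E.RowFinite) :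
    E.IsToeplitzCuntzKrieger E.toeplitzEdge E.toeplitzVertex :=
  IsToeplitzCuntzKrieger.of_jointly_injective (A := E.universalSubalgebra fun _ _ _ _ => True)
    hfin universalEval universalEval_jointly_injective fun i => i.isToeplitzCuntzKrieger

theorem isCuntzKrieger_graph (hfin : E.RowFinite) :
    E.IsCuntzKrieger E.graphEdge E.graphVertex :=
  IsCuntzKrieger.of_jointly_injective
    (A := E.universalSubalgebra fun _ _ s p => E.IsCuntzKrieger s p)
    hfin universalEval universalEval_jointly_injective fun i => i.prop

theorem exists_toeplitzAlgebra_hom (hfin : E.RowFinite) {B : Type w}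
    [NonUnitalCStarAlgebra B] {s : E.edge → B} {p : E.vertex → B}
    (h : E.IsToeplitzCuntzKrieger s p) :
    ∃ π : E.ToeplitzAlgebra →⋆ₙₐ[ℂ] B,
      (∀ e, π (E.toeplitzEdge e) = s e) ∧ ∀ v, π (E.toeplitzVertex v) = p v := by
  obtain ⟨π, hπ⟩ := exists_universalSubalgebra_hom (P := fun _ _ _ _ => True) hfin h
    fun _ _ _ _ _ _ _ _ => trivial
  exact ⟨π, fun e => hπ (.inl e), fun v => hπ (.inr v)⟩

theorem exists_graphAlgebra_hom (hfin : E.RowFinite) {B : Type w}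
    [NonUnitalCStarAlgebra B] {s : E.edge → B} {p : E.vertex → B}
    (h : E.IsCuntzKrieger s p) :
    ∃ π : E.GraphAlgebra →⋆ₙₐ[ℂ] B,
      (∀ e, π (E.graphEdge e) = s e) ∧ ∀ v, π (E.graphVertex v) = p v := by
  obtain ⟨π, hπ⟩ := exists_universalSubalgebra_hom (P := fun _ _ s p => E.IsCuntzKrieger s p)
    hfin h.toIsToeplitzCuntzKrieger fun C _ φ hφ s' p' hs hp =>
      .of_jointly_injective (ι := Unit) hfin (fun _ => φ) (fun a b hab => hφ (hab ()))
        fun _ => by simpa only [hs, hp] using h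
  exact ⟨π, fun e => hπ (.inl e), fun v => hπ (.inr v)⟩

variable (E) in
theorem topologicalClosure_adjoin_toeplitz :
    (NonUnitalStarAlgebra.adjoin ℂ
      (Set.range (Sum.elim E.toeplitzEdge E.toeplitzVertex))).topologicalClosure = ⊤ := by
  have : Sum.elim E.toeplitzEdge E.toeplitzVertex =
      E.universalGen fun _ _ _ _ => True := by
    funext x
    cases x <;> rfl
  rw [this]
  exact E.topologicalClosure_adjoin_universalGen _

theorem toeplitzAlgebra_hom_ext {B : Type w} [NonUnitalCStarAlgebra B]
    {φ ψ : E.ToeplitzAlgebra →⋆ₙₐ[ℂ] B}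
    (hs : ∀ e, φ (E.toeplitzEdge e) = ψ (E.toeplitzEdge e))
    (hp : ∀ v, φ (E.toeplitzVertex v) = ψ (E.toeplitzVertex v)) : φ = ψ :=
  NonUnitalStarAlgHom.ext_of_topologicalClosure_adjoin E.topologicalClosure_adjoin_toeplitz
    fun x => by cases x <;> simp [hs, hp]

end Universal

end DirectedGraph

theorem IsStarProjection.sum_of_orthogonal {A ι : Type*} [NonUnitalRing A] [StarRing A]
    [Fintype ι] {p : ι → A} (hp : ∀ i, IsStarProjection (p i))
    (h : ∀ i j, i ≠ j → p i * p j = 0) : IsStarProjection (∑ i, p i) where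
  isIdempotentElem := by
    rw [IsIdempotentElem, Finset.sum_mul]
    refine Finset.sum_congr rfl fun i _ => ?_
    rw [Finset.mul_sum, Finset.sum_eq_single i (fun j _ hj => h i j hj.symm) (by simp)]
    exact (hp i).isIdempotentElem
  isSelfAdjoint := by
    rw [isSelfAdjoint_iff, star_sum]
    exact Finset.sum_congr rfl fun i _ => (hp i).isSelfAdjoint

namespace DirectedGraph

/-! ### Paths and the combinatorics of the Kribs–Solel graph -/

section Paths

variable {E : DirectedGraph.{u}}

theorem RowFinite.finite_words (hfin : E.RowFinite) (n : ℕ) (v : E.vertex) :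
    {l : List E.edge | E.IsWordFrom v l ∧ l.length < n}.Finite := by
  induction n generalizing v with
  | zero => simp
  | succ n ih =>
    refine ((Set.finite_singleton []).union ((hfin v).biUnion fun e _ =>
      (ih (E.s e)).image (List.cons e))).subset ?_
    rintro (_ | ⟨e, l⟩) ⟨hl, hn⟩
    · exact Or.inl rfl
    · exact Or.inr (Set.mem_biUnion (x := e) hl.1 ⟨l, ⟨hl.2, Nat.lt_of_succ_lt_succ hn⟩, rfl⟩)

theorem RowFinite.finite_pathLT (hfin : E.RowFinite) (n : ℕ) (v : E.vertex) :
    Finite {μ : E.PathLT n // μ.range = v} := by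
  have := (hfin.finite_words n v).to_subtype
  refine Finite.of_injective (β := {l : List E.edge | E.IsWordFrom v l ∧ l.length < n})
    (fun μ => ⟨μ.1.1.word, by obtain ⟨μ, rfl⟩ := μ; exact μ.1.isWord, μ.1.2⟩) ?_
  intro μ ν h
  exact Subtype.ext (Subtype.ext (Path.ext (μ.2.trans ν.2.symm) (congrArg Subtype.val h)))

/-- The edge `(e, μ)` of the Kribs–Solel graph. -/
def kribsSolelEdge {n : ℕ} (e : E.edge) (μ : E.PathLT n) (h : μ.range = E.s e) :
    (E.kribsSolel n).edge :=
  ⟨(e, μ), h⟩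

/-- The edges of `E(n)`, sorted by the range of their first component. -/
def kribsSolelEdgeEquiv (E : DirectedGraph.{u}) (n : ℕ) (v : E.vertex) :
    (Σ f : {f : E.edge // E.r f = v}, {μ : E.PathLT n // μ.range = E.s f}) ≃
      {x : (E.kribsSolel n).edge // E.r x.1.1 = v} where
  toFun y := ⟨kribsSolelEdge y.1.1 y.2.1 y.2.2, y.1.2⟩
  invFun x := ⟨⟨x.1.1.1, x.2⟩, ⟨x.1.1.2, x.1.2⟩⟩
  left_inv _ := rfl
  right_inv _ := rfl

/-- Both eμ and r(e) have range r(e). Hence an edge of `E(n)` ending in vE^{<n} has its first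
component in vE¹. -/
theorem kribsSolel_r_range {n : ℕ} (x : (E.kribsSolel n).edge) :
    PathLT.range ((E.kribsSolel n).r x) = E.r x.1.1 := by
  simp only [kribsSolel]
  split_ifs <;> rfl

theorem kribsSolel_r_of_lt {n : ℕ} {e : E.edge} {μ : E.PathLT n} (h : μ.range = E.s e)
    (hl : μ.length + 1 < n) :
    (E.kribsSolel n).r (kribsSolelEdge e μ h) = PathLT.cons e μ h hl :=
  dif_pos hl

theorem kribsSolel_r_of_not_lt {n : ℕ} {e : E.edge} {μ : E.PathLT n} (h : μ.range = E.s e)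
    (hl : ¬ μ.length + 1 < n) :
    (E.kribsSolel n).r (kribsSolelEdge e μ h) = PathLT.ofVertex (Nat.zero_lt_of_lt μ.2) (E.r e) :=
  dif_neg hl

theorem PathLT.cons_ne_ofVertex {n : ℕ} {e : E.edge} {μ : E.PathLT n} (h : μ.range = E.s e)
    (hl : μ.length + 1 < n) (hn : 0 < n) (v : E.vertex) :
    PathLT.cons e μ h hl ≠ PathLT.ofVertex hn v := fun h' =>
  List.cons_ne_nil _ _ (congrArg (fun ν : E.PathLT n => ν.1.word) h')

theorem PathLT.cons_injective {n : ℕ} {e : E.edge} {μ ν : E.PathLT n} {h : μ.range = E.s e}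
    {hl : μ.length + 1 < n} {h' : ν.range = E.s e} {hl' : ν.length + 1 < n}
    (heq : PathLT.cons e μ h hl = PathLT.cons e ν h' hl') : μ = ν :=
  Subtype.ext (Path.ext (h.trans h'.symm)
    (List.cons_injective (congrArg (fun ν : E.PathLT n => ν.1.word) heq)))

theorem RowFinite.kribsSolel (hfin : E.RowFinite) (n : ℕ) : (E.kribsSolel n).RowFinite := by
  intro μ
  have : ({x : E.edge × E.PathLT n | E.r x.1 = PathLT.range μ ∧ x.2.range = E.s x.1}).Finite := by
    refine ((hfin (PathLT.range μ)).biUnion (t := fun e =>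
      Prod.mk e '' {ν : E.PathLT n | ν.range = E.s e}) fun e _ =>
        Set.Finite.image _ (Set.finite_coe_iff.1 (hfin.finite_pathLT n _))).subset ?_
    rintro ⟨e, ν⟩ ⟨he, hν⟩
    exact Set.mem_biUnion (x := e) he ⟨ν, hν, rfl⟩
  refine (this.preimage (f := Subtype.val) Subtype.val_injective.injOn).subset ?_
  rintro x rfl
  exact ⟨(kribsSolel_r_range x).symm, x.2⟩

end Paths

/-! ### From `E(n)`-families to Toeplitz `n`-representations -/

section FromKribsSolel

variable {E : DirectedGraph.{u}} {n : ℕ} {A : Type w} [NonUnitalCStarAlgebra A]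
  {t : (E.kribsSolel n).edge → A} {q : E.PathLT n → A}

theorem star_edgeSum_mul (hfin : E.RowFinite) (t : (E.kribsSolel n).edge → A) (e : E.edge)
    (a : A) :
    star (∑ᶠ ν : {ν : E.PathLT n // ν.range = E.s e}, t (kribsSolelEdge e ν.1 ν.2)) * a =
      ∑ᶠ ν : {ν : E.PathLT n // ν.range = E.s e}, star (t (kribsSolelEdge e ν.1 ν.2)) * a := by
  have := hfin.finite_pathLT n (E.s e)
  have := Fintype.ofFinite {ν : E.PathLT n // ν.range = E.s e}
  rw [finsum_eq_sum_of_fintype, finsum_eq_sum_of_fintype, star_sum, Finset.sum_mul]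

namespace IsToeplitzCuntzKrieger

/-- The source projections of the summands are the mutually orthogonal q_ν, so q_μ cuts out a single
summand. This recovers the `E(n)`-family from its sums. -/
theorem edgeSum_mul (hfin : E.RowFinite) (h : (E.kribsSolel n).IsToeplitzCuntzKrieger t q)
    {e : E.edge} {μ : E.PathLT n} (hμ : μ.range = E.s e) :
    (∑ᶠ ν : {ν : E.PathLT n // ν.range = E.s e}, t (kribsSolelEdge e ν.1 ν.2)) * q μ =
      t (kribsSolelEdge e μ hμ) := by
  have := hfin.finite_pathLT n (E.s e)
  have := Fintype.ofFinite {ν : E.PathLT n // ν.range = E.s e}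
  rw [finsum_eq_sum_of_fintype, Finset.sum_mul, Finset.sum_eq_single ⟨μ, hμ⟩ _ (by simp)]
  · exact h.mul_vertex _
  · intro ν _ hν
    rw [← h.mul_vertex (kribsSolelEdge e ν.1 ν.2), mul_assoc]
    exact mul_eq_zero_of_right _ (h.orthogonal _ _ fun h => hν (Subtype.ext h))

theorem star_edge_mul_vertex (hfin : E.RowFinite)
    (h : (E.kribsSolel n).IsToeplitzCuntzKrieger t q) (x : (E.kribsSolel n).edge) :
    star (t x) * q ((E.kribsSolel n).r x) = star (t x) := by
  have := congrArg star (h.vertex_mul (hfin.kribsSolel n) x)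
  rwa [star_mul, (h.projection _).isSelfAdjoint.star_eq] at this

theorem star_edge_mul_vertex_of_ne (hfin : E.RowFinite)
    (h : (E.kribsSolel n).IsToeplitzCuntzKrieger t q) (x : (E.kribsSolel n).edge)
    {μ : E.PathLT n} (hμ : (E.kribsSolel n).r x ≠ μ) : star (t x) * q μ = 0 := by
  rw [← h.star_edge_mul_vertex hfin, mul_assoc]
  exact mul_eq_zero_of_right _ (h.orthogonal _ _ hμ)

theorem star_edgeSum_mul_edge (hfin : E.RowFinite)
    (h : (E.kribsSolel n).IsToeplitzCuntzKrieger t q) {e : E.edge} {μ : E.PathLT n}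
    (hμ : μ.range = E.s e) :
    star (∑ᶠ ν : {ν : E.PathLT n // ν.range = E.s e}, t (kribsSolelEdge e ν.1 ν.2)) * t (kribsSolelEdge e μ hμ) =
      q μ := by
  have := hfin.finite_pathLT n (E.s e)
  have := Fintype.ofFinite {ν : E.PathLT n // ν.range = E.s e}
  rw [finsum_eq_sum_of_fintype, star_sum, Finset.sum_mul, Finset.sum_eq_single ⟨μ, hμ⟩ _ (by simp)]
  · exact h.star_mul_self _
  · intro ν _ hν
    refine h.star_mul_of_ne (hfin.kribsSolel n) fun h => hν (Subtype.ext ?_)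
    exact congrArg (fun x => x.1.2) h

theorem star_edgeSum_mul_edge_of_ne (hfin : E.RowFinite)
    (h : (E.kribsSolel n).IsToeplitzCuntzKrieger t q) {e f : E.edge} (hef : e ≠ f)
    {μ : E.PathLT n} (hμ : μ.range = E.s f) :
    star (∑ᶠ ν : {ν : E.PathLT n // ν.range = E.s e}, t (kribsSolelEdge e ν.1 ν.2)) * t (kribsSolelEdge f μ hμ) =
      0 := by
  have := hfin.finite_pathLT n (E.s e)
  have := Fintype.ofFinite {ν : E.PathLT n // ν.range = E.s e}
  rw [finsum_eq_sum_of_fintype, star_sum, Finset.sum_mul]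
  refine Finset.sum_eq_zero fun ν _ => h.star_mul_of_ne (hfin.kribsSolel n) fun h => hef ?_
  exact congrArg (fun x => x.1.1) h

theorem vertexSum_mul_edge (hfin : E.RowFinite)
    (h : (E.kribsSolel n).IsToeplitzCuntzKrieger t q) (x : (E.kribsSolel n).edge) :
    (∑ᶠ ν : {ν : E.PathLT n // ν.range = E.r x.1.1}, q ν) * t x = t x := by
  have := hfin.finite_pathLT n (E.r x.1.1)
  have := Fintype.ofFinite {ν : E.PathLT n // ν.range = E.r x.1.1}
  rw [finsum_eq_sum_of_fintype, Finset.sum_mul,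
    Finset.sum_eq_single ⟨(E.kribsSolel n).r x, kribsSolel_r_range x⟩ _ (by simp)]
  · exact h.vertex_mul (hfin.kribsSolel n) x
  · intro ν _ hν
    rw [← h.vertex_mul (hfin.kribsSolel n), ← mul_assoc]
    exact mul_eq_zero_of_left (h.orthogonal _ _ fun h => hν (Subtype.ext h)) _

/-- Summing a Toeplitz–Cuntz–Krieger `E(n)`-family gives a Toeplitz–Cuntz–Krieger `E`-family. -/
theorem sum_kribsSolel (hfin : E.RowFinite)
    (h : (E.kribsSolel n).IsToeplitzCuntzKrieger t q) :
    E.IsToeplitzCuntzKrieger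
      (fun e => ∑ᶠ μ : {μ : E.PathLT n // μ.range = E.s e}, t (kribsSolelEdge e μ.1 μ.2))
      (fun v => ∑ᶠ μ : {μ : E.PathLT n // μ.range = v}, q μ) := by
  have := hfin.finite_pathLT n
  have : ∀ v, Fintype {μ : E.PathLT n // μ.range = v} := fun v => Fintype.ofFinite _
  have h4 : ∀ e, star (∑ᶠ μ : {μ : E.PathLT n // μ.range = E.s e}, t (kribsSolelEdge e μ.1 μ.2)) *
      (∑ᶠ μ : {μ : E.PathLT n // μ.range = E.s e}, t (kribsSolelEdge e μ.1 μ.2)) =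
      ∑ᶠ μ : {μ : E.PathLT n // μ.range = E.s e}, q μ := by
    intro e
    conv_lhs =>
      rhs
      rw [finsum_eq_sum_of_fintype]
    rw [Finset.mul_sum, finsum_eq_sum_of_fintype (fun μ : {μ : E.PathLT n // μ.range = E.s e} => q μ)]
    exact Finset.sum_congr rfl fun μ _ => h.star_edgeSum_mul_edge hfin μ.2
  refine .of_relations hfin (fun e => ?_) (fun v => ?_) (fun v v' hv => ?_) h4 (fun e => ?_)
    (fun e f hef => ?_)
  · rw [mul_assoc, h4, finsum_eq_sum_of_fintype (fun μ : {μ : E.PathLT n // μ.range = E.s e} => q μ),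
      Finset.mul_sum, finsum_eq_sum_of_fintype]
    refine Finset.sum_congr rfl fun μ _ => ?_
    rw [← finsum_eq_sum_of_fintype]
    exact h.edgeSum_mul hfin μ.2
  · rw [finsum_eq_sum_of_fintype]
    exact .sum_of_orthogonal (fun μ => h.projection _)
      fun μ ν hμν => h.orthogonal _ _ fun h => hμν (Subtype.ext h)
  · rw [finsum_eq_sum_of_fintype, finsum_eq_sum_of_fintype, Finset.sum_mul]
    refine Finset.sum_eq_zero fun μ _ => ?_
    rw [Finset.mul_sum]
    refine Finset.sum_eq_zero fun ν _ => h.orthogonal _ _ ?_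
    rintro h'
    exact hv (μ.2.symm.trans ((congrArg PathLT.range h').trans ν.2))
  · rw [finsum_eq_sum_of_fintype (fun μ : {μ : E.PathLT n // μ.range = E.s e} =>
      t (kribsSolelEdge e μ.1 μ.2)), Finset.mul_sum]
    exact Finset.sum_congr rfl fun μ _ =>
      h.vertexSum_mul_edge hfin (kribsSolelEdge e μ.1 μ.2)
  · conv_lhs =>
      rhs
      rw [finsum_eq_sum_of_fintype]
    rw [Finset.mul_sum]
    exact Finset.sum_eq_zero fun μ _ => h.star_edgeSum_mul_edge_of_ne hfin hef μ.2

/-- A Toeplitz–Cuntz–Krieger `E(n)`-family gives a Toeplitz `n`-representation of `E`. -/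
theorem isToeplitzNRep [NeZero n] (hfin : E.RowFinite)
    (h : (E.kribsSolel n).IsToeplitzCuntzKrieger t q) :
    E.IsToeplitzNRep n
      (fun e => ∑ᶠ μ : {μ : E.PathLT n // μ.range = E.s e}, t (kribsSolelEdge e μ.1 μ.2))
      (fun v => ∑ᶠ μ : {μ : E.PathLT n // μ.range = v}, q μ) q := by
  have hq : ∀ {e : E.edge} {μ : E.PathLT n} (hμ : μ.range = E.s e),
      q μ * star (∑ᶠ ν : {ν : E.PathLT n // ν.range = E.s e}, t (kribsSolelEdge e ν.1 ν.2)) =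
        star (t (kribsSolelEdge e μ hμ)) := fun {e μ} hμ => by
    rw [← h.edgeSum_mul hfin hμ, star_mul, (h.projection μ).isSelfAdjoint.star_eq]
  refine ⟨h.sum_kribsSolel hfin, h.projection, h.orthogonal, fun _ => rfl,
    fun e μ hμ hl => ?_, fun e => ?_, fun e μ hcons hvert => ?_⟩
  -- The summand at ν survives only if (e,ν) has range eμ. As eμ has positive length, this forces ν
  -- = μ.
  · rw [star_edgeSum_mul hfin, hq hμ, finsum_eq_single _ ⟨μ, hμ⟩]
    · rw [← kribsSolel_r_of_lt hμ hl]
      exact h.star_edge_mul_vertex hfin _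
    · intro ν hν
      refine h.star_edge_mul_vertex_of_ne hfin _ fun h' => hν (Subtype.ext ?_)
      by_cases hl' : ν.1.length + 1 < n
      · rw [kribsSolel_r_of_lt ν.2 hl'] at h'
        exact PathLT.cons_injective h'
      · rw [kribsSolel_r_of_not_lt ν.2 hl'] at h'
        exact absurd h'.symm (PathLT.cons_ne_ofVertex hμ hl _ _)
  · rw [star_edgeSum_mul hfin]
    set T := ∑ᶠ ν : {ν : E.PathLT n // ν.range = E.s e}, t (kribsSolelEdge e ν.1 ν.2) with hT
    -- Both sides become sums of ν ↦ q_ν T_e^* q_{r(e)}, over different sets of ν. The terms with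
    -- |ν| < n - 1 vanish, because (e,ν) then ends at eν, which is not a vertex.
    have h1 : ∀ ν : {ν : E.PathLT n // ν.range = E.s e},
        star (t (kribsSolelEdge e ν.1 ν.2)) * q (PathLT.ofVertex (NeZero.pos n) (E.r e)) =
        q ν * star T * q (PathLT.ofVertex (NeZero.pos n) (E.r e)) := fun ν => by
      rw [hq ν.2]
    rw [finsum_congr h1, finsum_subtype_eq_finsum_cond (fun ν => ν.range = E.s e)
        (f := fun ν => q ν * star T * q (PathLT.ofVertex (NeZero.pos n) (E.r e))),
      finsum_subtype_eq_finsum_cond (fun ν => ν.range = E.s e ∧ ν.length + 1 = n)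
        (f := fun ν => q ν * star T)]
    have h2 : ∀ ν : E.PathLT n, ν.range = E.s e ∧ ν.length + 1 = n →
        q ν * star T = q ν * star T * q (PathLT.ofVertex (NeZero.pos n) (E.r e)) := by
      rintro ν ⟨hν, hl⟩
      rw [hq hν, ← kribsSolel_r_of_not_lt hν hl.not_lt]
      exact (h.star_edge_mul_vertex hfin _).symm
    refine Eq.trans ?_ (finsum_mem_congr (s := {ν : E.PathLT n | ν.range = E.s e ∧ ν.length + 1 = n}) rfl
      h2).symm
    refine finsum_mem_inter_support_eq' _ {ν : E.PathLT n | ν.range = E.s e} _ fun ν hν => ?_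
    refine ⟨fun hr => ⟨hr, ?_⟩, fun hr => hr.1⟩
    by_contra hl
    refine hν ?_
    have hr' : ν.range = E.s e := hr
    have hl' : ν.length + 1 < n := lt_of_le_of_ne ν.2 hl
    simp only [hT]
    rw [hq hr']
    refine h.star_edge_mul_vertex_of_ne hfin _ ?_
    rw [kribsSolel_r_of_lt hr' hl']
    exact PathLT.cons_ne_ofVertex _ _ _ _
  · rw [star_edgeSum_mul hfin]
    refine finsum_eq_zero_of_forall_eq_zero fun ν =>
      h.star_edge_mul_vertex_of_ne hfin _ fun h' => ?_
    by_cases hl : ν.1.length + 1 < n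
    · rw [kribsSolel_r_of_lt ν.2 hl] at h'
      exact hcons ⟨ν.1, ν.2, hl, h'.symm⟩
    · rw [kribsSolel_r_of_not_lt ν.2 hl] at h'
      exact hvert h'.symm

end IsToeplitzCuntzKrieger

end FromKribsSolel

end DirectedGraph

/-! ### From Toeplitz `n`-representations to `E(n)`-families -/

namespace DirectedGraph

variable {E : DirectedGraph.{u}} {n : ℕ}

namespace IsToeplitzNRep

variable [NeZero n] {A : Type w} [NonUnitalCStarAlgebra A]
  {T : E.edge → A} {Q : E.vertex → A} {Θ : E.PathLT n → A}

theorem vertex_mul_theta (hfin : E.RowFinite) (h : E.IsToeplitzNRep n T Q Θ) (μ : E.PathLT n) :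
    Q μ.range * Θ μ = Θ μ := by
  have := hfin.finite_pathLT n μ.range
  have := Fintype.ofFinite {ν : E.PathLT n // ν.range = μ.range}
  rw [h.sum_eq, finsum_eq_sum_of_fintype, Finset.sum_mul, Finset.sum_eq_single ⟨μ, rfl⟩ _ (by simp)]
  · exact (h.projection μ).isIdempotentElem
  · exact fun ν _ hν => h.orthogonal _ _ fun h => hν (Subtype.ext h)

/-- This is the adjoint of the formula for T_e^* Θ at the range of (e,μ), multiplied by Θ_μ on the
right. When |μ| = n - 1, that factor selects ν = μ from the sum. -/
theorem theta_r_mul (h : E.IsToeplitzNRep n T Q Θ) (hfin : E.RowFinite) {e : E.edge}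
    {μ : E.PathLT n} (hμ : μ.range = E.s e) :
    Θ ((E.kribsSolel n).r (kribsSolelEdge e μ hμ)) * (T e * Θ μ) = T e * Θ μ := by
  by_cases hl : μ.length + 1 < n
  · have h1 := congrArg star (h.rel_cons e μ hμ hl)
    rw [star_mul, star_mul, star_star, (h.projection _).isSelfAdjoint.star_eq,
      (h.projection _).isSelfAdjoint.star_eq] at h1
    rw [kribsSolel_r_of_lt hμ hl, ← mul_assoc, h1, mul_assoc,
      (h.projection μ).isIdempotentElem.eq]
  · have := hfin.finite_pathLT n (E.s e)
    have : Finite {ν : E.PathLT n // ν.range = E.s e ∧ ν.length + 1 = n} :=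
      Finite.of_injective (β := {ν : E.PathLT n // ν.range = E.s e})
        (fun ν => ⟨ν.1, ν.2.1⟩) fun ν ν' h =>
          Subtype.ext (congrArg (fun κ : {κ : E.PathLT n // κ.range = E.s e} => κ.1) h)
    have := Fintype.ofFinite {ν : E.PathLT n // ν.range = E.s e ∧ ν.length + 1 = n}
    have h1 := congrArg star (h.rel_vertex e)
    simp only [finsum_eq_sum_of_fintype, star_mul, star_star, star_sum,
      (h.projection _).isSelfAdjoint.star_eq] at h1
    have hl' : μ.length + 1 = n := le_antisymm μ.2 (not_lt.1 hl)
    rw [kribsSolel_r_of_not_lt hμ hl, ← mul_assoc, h1, Finset.sum_mul,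
      Finset.sum_eq_single ⟨μ, hμ, hl'⟩ _ (by simp), mul_assoc,
      (h.projection μ).isIdempotentElem.eq]
    intro ν _ hν
    rw [mul_assoc, h.orthogonal _ _ fun h => hν (Subtype.ext h), mul_zero]

theorem star_mul_self (hfin : E.RowFinite) (h : E.IsToeplitzNRep n T Q Θ) {e : E.edge}
    {μ : E.PathLT n} (hμ : μ.range = E.s e) :
    star (T e * Θ μ) * (T e * Θ μ) = Θ μ := by
  rw [star_mul, (h.projection _).isSelfAdjoint.star_eq, mul_assoc, ← mul_assoc (star (T e)),
    h.isToeplitzCuntzKrieger.star_mul_self, ← hμ, h.vertex_mul_theta hfin,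
    (h.projection μ).isIdempotentElem.eq]

/-- A Toeplitz `n`-representation of `E` gives a Toeplitz–Cuntz–Krieger `E(n)`-family. -/
theorem isToeplitzCuntzKrieger_kribsSolel (hfin : E.RowFinite)
    (h : E.IsToeplitzNRep n T Q Θ) :
    (E.kribsSolel n).IsToeplitzCuntzKrieger (fun x => T x.1.1 * Θ x.1.2) Θ := by
  refine .of_relations (hfin.kribsSolel n) (fun x => ?_) h.projection h.orthogonal
    (fun x => h.star_mul_self hfin x.2) (fun x => h.theta_r_mul hfin x.2) (fun x y hxy => ?_)
  · rw [mul_assoc, h.star_mul_self hfin x.2, mul_assoc, (h.projection x.1.2).isIdempotentElem.eq]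
  · rw [star_mul, (h.projection _).isSelfAdjoint.star_eq, mul_assoc, ← mul_assoc (star (T _))]
    by_cases he : x.1.1 = y.1.1
    · rw [he, h.isToeplitzCuntzKrieger.star_mul_self, ← y.2, h.vertex_mul_theta hfin]
      exact h.orthogonal _ _ fun hμ => hxy (Subtype.ext (Prod.ext he hμ))
    · rw [h.isToeplitzCuntzKrieger.star_mul_of_ne hfin he, zero_mul, mul_zero]

/-- Expand Q_{r(μ)} in Q_{r(μ)} Θ_μ = Θ_μ by the Cuntz–Krieger relation, then insert Q_{s(f)} = ∑
Θ_ν between T_f and T_f^*. The index set still contains edges that do not end at μ. -/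
theorem sum_edges_mul_theta (hfin : E.RowFinite) (h : E.IsToeplitzNRep n T Q Θ)
    (hCK : E.IsCuntzKrieger T Q) (μ : E.PathLT n) :
    ∑ᶠ x : {x : (E.kribsSolel n).edge // E.r x.1.1 = μ.range},
      T x.1.1.1 * Θ x.1.1.2 * star (T x.1.1.1) * Θ μ = Θ μ := by
  have := hfin.finite
  have := hfin.finite_pathLT n
  have : Fintype {f : E.edge // E.r f = μ.range} := Fintype.ofFinite _
  have : ∀ v, Fintype {ν : E.PathLT n // ν.range = v} := fun v => Fintype.ofFinite _
  rw [← finsum_comp_equiv (kribsSolelEdgeEquiv E n μ.range), finsum_eq_sum_of_fintype,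
    Fintype.sum_sigma]
  conv_rhs => rw [← h.vertex_mul_theta hfin, ← hCK.sum_eq, finsum_eq_sum_of_fintype,
    Finset.sum_mul]
  refine Finset.sum_congr rfl fun f _ => ?_
  have hQ : Q (E.s f) * star (T f) = star (T f) := by
    have := congrArg star (hCK.mul_vertex f)
    rwa [star_mul, (hCK.projection _).isSelfAdjoint.star_eq] at this
  conv_rhs => rw [← hQ, h.sum_eq, finsum_eq_sum_of_fintype, Finset.sum_mul, Finset.mul_sum,
    Finset.sum_mul]
  refine Finset.sum_congr rfl fun ν _ => ?_
  simp only [mul_assoc]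
  rfl

theorem edge_mul_theta (hfin : E.RowFinite) (h : E.IsToeplitzNRep n T Q Θ)
    (x : (E.kribsSolel n).edge) :
    T x.1.1 * Θ x.1.2 * star (T x.1.1) * Θ ((E.kribsSolel n).r x) =
      T x.1.1 * Θ x.1.2 * star (T x.1.1) := by
  have h1 := congrArg star (h.theta_r_mul hfin x.2)
  have h2 : star (Θ ((E.kribsSolel n).r x)) = Θ ((E.kribsSolel n).r x) :=
    (h.projection _).isSelfAdjoint.star_eq
  rw [star_mul, star_mul, (h.projection x.1.2).isSelfAdjoint.star_eq] at h1
  rw [mul_assoc (T _), mul_assoc (T _)]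
  refine congrArg (T x.1.1 * ·) (Eq.trans ?_ h1)
  exact congrArg (Θ x.1.2 * star (T x.1.1) * ·) h2.symm

/-- A Toeplitz `n`-representation whose underlying `E`-family is Cuntz–Krieger gives a
Cuntz–Krieger `E(n)`-family. -/
theorem isCuntzKrieger_kribsSolel (hfin : E.RowFinite) (h : E.IsToeplitzNRep n T Q Θ)
    (hCK : E.IsCuntzKrieger T Q) :
    (E.kribsSolel n).IsCuntzKrieger (fun x => T x.1.1 * Θ x.1.2) Θ where
  toIsToeplitzCuntzKrieger := h.isToeplitzCuntzKrieger_kribsSolel hfin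
  sum_eq μ := by
    have h1 : ∀ x : (E.kribsSolel n).edge, T x.1.1 * Θ x.1.2 * star (T x.1.1 * Θ x.1.2) =
        T x.1.1 * Θ x.1.2 * star (T x.1.1) := fun x => by
      rw [star_mul, (h.projection _).isSelfAdjoint.star_eq, mul_assoc (T _),
        ← mul_assoc (Θ _), (h.projection _).isIdempotentElem.eq, mul_assoc (T _)]
    refine Eq.trans ?_ (h.sum_edges_mul_theta hfin hCK μ)
    simp only [h1]
    rw [finsum_subtype_eq_finsum_cond (fun x => (E.kribsSolel n).r x = μ)
        (f := fun x : (E.kribsSolel n).edge => T x.1.1 * Θ x.1.2 * star (T x.1.1)),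
      finsum_subtype_eq_finsum_cond (fun x : (E.kribsSolel n).edge => E.r x.1.1 = μ.range)
        (f := fun x : (E.kribsSolel n).edge => T x.1.1 * Θ x.1.2 * star (T x.1.1) * Θ μ)]
    have h2 : ∀ x : (E.kribsSolel n).edge, (E.kribsSolel n).r x = μ →
        T x.1.1 * Θ x.1.2 * star (T x.1.1) = T x.1.1 * Θ x.1.2 * star (T x.1.1) * Θ μ := by
      rintro x rfl
      exact (h.edge_mul_theta hfin x).symm
    refine (finsum_mem_congr (s := {x : (E.kribsSolel n).edge | (E.kribsSolel n).r x = μ})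
      rfl h2).trans ?_
    -- Surplus edges drop out: each term absorbs Θ at the range of its edge, which is orthogonal to
    -- Θ_μ unless that range is μ.
    refine finsum_mem_inter_support_eq' _ _
      {x : (E.kribsSolel n).edge | E.r x.1.1 = μ.range} fun x hx => ?_
    refine ⟨fun hr => ?_, fun _ => ?_⟩
    · exact (kribsSolel_r_range x).symm.trans (congrArg PathLT.range hr)
    · by_contra hr
      refine hx ?_
      simp only
      rw [← h.edge_mul_theta hfin, mul_assoc, h.orthogonal _ _ hr, mul_zero]

end IsToeplitzNRep

/-! ### Generation and the universal property -/

theorem nEdge_mul_nTheta (hfin : E.RowFinite) {e : E.edge} {μ : E.PathLT n}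
    (hμ : μ.range = E.s e) :
    E.nEdge n e * E.nTheta n μ = (E.kribsSolel n).toeplitzEdge (kribsSolelEdge e μ hμ) :=
  (isToeplitzCuntzKrieger_toeplitz (hfin.kribsSolel n)).edgeSum_mul hfin hμ

theorem topologicalClosure_adjoin_nRep (hfin : E.RowFinite) :
    (NonUnitalStarAlgebra.adjoin ℂ
      (Set.range (E.nEdge n) ∪ Set.range (E.nVertex n) ∪
        Set.range (E.nTheta n))).topologicalClosure = ⊤ := by
  rw [eq_top_iff, ← topologicalClosure_adjoin_toeplitz]
  refine NonUnitalStarSubalgebra.topologicalClosure_mono (NonUnitalStarAlgebra.adjoin_le ?_)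
  rintro _ ⟨x | μ, rfl⟩
  · have := nEdge_mul_nTheta hfin x.2
    rw [Sum.elim_inl]
    refine (congrArg (· ∈ _) this).mp (mul_mem ?_ ?_)
    · exact NonUnitalStarAlgebra.subset_adjoin ℂ _ (.inl (.inl ⟨_, rfl⟩))
    · exact NonUnitalStarAlgebra.subset_adjoin ℂ _ (.inr ⟨_, rfl⟩)
  · exact NonUnitalStarAlgebra.subset_adjoin ℂ _ (.inr ⟨μ, rfl⟩)

end DirectedGraph

theorem mainTheorem7 (E : DirectedGraph.{u}) (hfin : E.RowFinite) (hsrc : E.NoSources)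
    (n : ℕ) [NeZero n] :
    -- the elements `t_{n,e}`, `q_{n,v}`, `θ_{n,μ}` are a Toeplitz `n`-representation
    E.IsToeplitzNRep n (E.nEdge n) (E.nVertex n) (E.nTheta n) ∧
    -- they generate `𝒯C*(E(n))` as a C*-algebra
    (NonUnitalStarAlgebra.adjoin ℂ
      (Set.range (E.nEdge n) ∪ Set.range (E.nVertex n) ∪
        Set.range (E.nTheta n))).topologicalClosure = ⊤ ∧
    -- `ρ` is the canonical homomorphism `𝒯C*(E(n)) → C*(E(n))`
    ∃ ρ : (E.kribsSolel n).ToeplitzAlgebra →⋆ₙₐ[ℂ] (E.kribsSolel n).GraphAlgebra,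
      (∀ x, ρ ((E.kribsSolel n).toeplitzEdge x) = (E.kribsSolel n).graphEdge x) ∧
      (∀ μ, ρ ((E.kribsSolel n).toeplitzVertex μ) = (E.kribsSolel n).graphVertex μ) ∧
      -- the universal property
      ∀ (B : Type w) [NonUnitalCStarAlgebra B] (T : E.edge → B) (Q : E.vertex → B)
        (Θ : E.PathLT n → B), E.IsToeplitzNRep n T Q Θ →
        ∃ π : (E.kribsSolel n).ToeplitzAlgebra →⋆ₙₐ[ℂ] B,
          (∀ e, π (E.nEdge n e) = T e) ∧ (∀ v, π (E.nVertex n v) = Q v) ∧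
          (∀ μ, π (E.nTheta n μ) = Θ μ) ∧
          -- in the Cuntz–Krieger case `π` factors through `C*(E(n))`
          (E.IsCuntzKrieger T Q →
            ∃ π' : (E.kribsSolel n).GraphAlgebra →⋆ₙₐ[ℂ] B, π = π'.comp ρ) := by
  have hF := hfin.kribsSolel n
  refine ⟨(DirectedGraph.isToeplitzCuntzKrieger_toeplitz hF).isToeplitzNRep hfin,
    DirectedGraph.topologicalClosure_adjoin_nRep hfin, ?_⟩
  obtain ⟨ρ, hρs, hρp⟩ := DirectedGraph.exists_toeplitzAlgebra_hom hF
    (DirectedGraph.isCuntzKrieger_graph hF).toIsToeplitzCuntzKrieger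
  refine ⟨ρ, hρs, hρp, fun B _ T Q Θ h => ?_⟩
  obtain ⟨π, hπs, hπp⟩ := DirectedGraph.exists_toeplitzAlgebra_hom hF
    (h.isToeplitzCuntzKrieger_kribsSolel hfin)
  have := hfin.finite_pathLT n
  have : ∀ v, Fintype {μ : E.PathLT n // μ.range = v} := fun v => Fintype.ofFinite _
  refine ⟨π, fun e => ?_, fun v => ?_, hπp, fun hCK => ?_⟩
  -- T_e = T_e Q_{s(e)} = ∑ T_e Θ_μ, the sum of the images of the t_(e,μ).
  · rw [← h.isToeplitzCuntzKrieger.mul_vertex e, h.sum_eq, DirectedGraph.nEdge,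
      finsum_eq_sum_of_fintype, finsum_eq_sum_of_fintype, map_sum, Finset.mul_sum]
    exact Finset.sum_congr rfl fun μ _ => hπs (DirectedGraph.kribsSolelEdge e μ.1 μ.2)
  · rw [h.sum_eq, DirectedGraph.nVertex, finsum_eq_sum_of_fintype, finsum_eq_sum_of_fintype,
      map_sum]
    exact Finset.sum_congr rfl fun μ _ => hπp μ.1
  · obtain ⟨π', hπs', hπp'⟩ := DirectedGraph.exists_graphAlgebra_hom hF
      (h.isCuntzKrieger_kribsSolel hfin hCK)
    refine ⟨π', DirectedGraph.toeplitzAlgebra_hom_ext (fun x => ?_) fun μ => ?_⟩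
    · rw [NonUnitalStarAlgHom.comp_apply, hρs, hπs, hπs']
    · rw [NonUnitalStarAlgHom.comp_apply, hρp, hπp, hπp']
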